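/- All Hilbert spaces are finite-dimensional, $\log$ is the binary logarithm and $-\log 0=\infty$; a state is a positive semidefinite operator of trace $1$. For a state $\rho$, a positive semidefinite operator $\sigma$ and $0\le\varepsilon\le1$, the hypothesis testing relative entropy $D_h^{\varepsilon}(\rho\|\sigma)$ is defined by $$2^{-D_h^{\varepsilon}(\rho\|\sigma)}=\inf\{\operatorname{tr}(Q\sigma) : 0\le Q\le 1,\ \operatorname{tr}(Q\rho)\ge 1-\varepsilon\},$$ and, for a state $\rho_{AB}$ and a state $\sigma_B$, $$H_h^{\varepsilon}(A|B)_{\rho|\sigma}=-D_h^{\varepsilon}(\rho_{AB}\,\|\,1_A\otimes\sigma_B),\qquad H_h^{\varepsilon}(A|B)_{\rho}=\max_{\sigma_B}H_h^{\varepsilon}(A|B)_{\rho|\sigma},$$ where the maximum is over all states $\sigma_B$ on $B$. We write $H_h^{\varepsilon}(A|B)_{\rho|\rho}$ when $\sigma_B$ is the marginal $\rho_B$. Let $\rho_{XB}=\sum_x p_x|x\rangle\langle x|\otimes\phi_B^x$ be a classical-quantum state: $p$ is a probability distribution, $\{|x\rangle\}$ is an orthonormal basis of $\mathscr H_X$,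 and each $\phi_B^x$ is a state. A compression protocol consists of a finite seed set $\mathcal S$ with a probability distribution $\{p_s\}$, a finite code book $\mathcal M$, for each $s\in\mathcal S$ an encoder function $e_s$ from the alphabet of $X$ to $\mathcal M$, and for each $s\in\mathcal S$, $m\in\mathcal M$ a POVM $\{M_x^{s,m}\}_x$ on $B$. Given the seed value $s$, which encoder and decoder share, the encoder sends $e_s(x)$, and on receiving $m$ the decoder measures $B$ with $\{M_x^{s,m}\}_x$; the outcome is $X'$. Its error probability is $p_{\mathrm{err}}=\sum_s p_s\Pr[X\ne X'\mid S=s]$. The minimal compression length $m^{\varepsilon}(X|B)_{\rho}$ is the least $m\in\mathbb N$ for which there is a protocol with $\log|\mathcal M|\le m$ and $p_{\mathrm{err}}\le\varepsilon$. **Theorem.** For every classical-quantum state $\rho_{XB}$ and all $0<\eta\le\varepsilon<1$, $$H_h^{\varepsilon}(X|B)_{\rho}\ \le\ m^{\varepsilon}(X|B)_{\rho}\ \le\ H_h^{\varepsilon-\eta}(X|B)_{\rho|\rho}+\log\frac{\varepsilon}{\eta^2}+3 .$$ -/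

import Mathlib

open scoped Kronecker BigOperators ComplexOrder

noncomputable section

namespace SourceCompression

/-- A normalized quantum state on the Hilbert space `ℂ^A`. -/
def IsState {A : Type*} [Fintype A] (ρ : Matrix A A ℂ) : Prop :=
  ρ.PosSemidef ∧ ρ.trace = 1

/-- Partial trace over the second tensor factor. -/
def traceRight {A B : Type*} [Fintype B] (L : Matrix (A × B) (A × B) ℂ) : Matrix A A ℂ :=
  Matrix.of fun a a' => ∑ b, L (a, b) (a', b)

/-- Partial trace over the first tensor factor. -/
def traceLeft {A B : Type*} [Fintype A] (L : Matrix (A × B) (A × B) ℂ) : Matrix B B ℂ :=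
  Matrix.of fun b b' => ∑ a, L (a, b) (a, b')

/-- A classical-quantum state `∑ x, p x |x⟩⟨x| ⊗ φ x`, where `p` is a probability distribution
and every `φ x` is a normalized state. -/
def IsCQState {X B : Type*} [Fintype X] [DecidableEq X] [Fintype B]
    (ρ : Matrix (X × B) (X × B) ℂ) : Prop :=
  ∃ (p : X → ℝ) (φ : X → Matrix B B ℂ), (∀ x, 0 ≤ p x) ∧ ∑ x, p x = 1 ∧ (∀ x, IsState (φ x)) ∧
    ρ = ∑ x, (p x : ℂ) • (Matrix.single x x (1 : ℂ) ⊗ₖ φ x)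

/-- The Hilbert-Schmidt inner product `tr (L† M)`; it is real for Hermitian arguments, and only
its real part is kept. -/
def hsInner {A : Type*} [Fintype A] (L M : Matrix A A ℂ) : ℝ :=
  (L.conjTranspose * M).trace.re

/-- Binary logarithm of a nonnegative real, with `log 0 = -∞`. -/
def elog2 (x : ℝ) : EReal :=
  if x ≤ 0 then ⊥ else ((Real.logb 2 x : ℝ) : EReal)

/-- A test `0 ≤ Q ≤ 1` that accepts `ρ` with probability at least `1 - ε`. -/
def IsTest {A : Type*} [Fintype A] [DecidableEq A] (ε : ℝ) (ρ Q : Matrix A A ℂ) : Prop :=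
  Q.PosSemidef ∧ (1 - Q).PosSemidef ∧ 1 - ε ≤ hsInner Q ρ

/-- The hypothesis testing relative entropy `D_h^ε(ρ‖σ)`, that is
`2 ^ (-D_h^ε(ρ‖σ)) = inf {⟨Q, σ⟩ | 0 ≤ Q ≤ 1, ⟨Q, ρ⟩ ≥ 1 - ε}`. -/
def relEntropyH {A : Type*} [Fintype A] [DecidableEq A] (ε : ℝ) (ρ σ : Matrix A A ℂ) : EReal :=
  -elog2 (sInf {t : ℝ | ∃ Q : Matrix A A ℂ, IsTest ε ρ Q ∧ t = hsInner Q σ})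

/-- The conditional entropy `H_h^ε(A|B)_{ρ|σ} = -D_h^ε(ρ_AB ‖ 1_A ⊗ σ_B)`. -/
def condEntropyHRel {A B : Type*} [Fintype A] [DecidableEq A] [Fintype B] [DecidableEq B]
    (ε : ℝ) (ρ : Matrix (A × B) (A × B) ℂ) (σ : Matrix B B ℂ) : EReal :=
  -relEntropyH ε ρ ((1 : Matrix A A ℂ) ⊗ₖ σ)

/-- The conditional entropy `H_h^ε(A|B)_ρ`, the maximum over all states `σ` on `B` of
`H_h^ε(A|B)_{ρ|σ}`. -/
def condEntropyH {A B : Type*} [Fintype A] [DecidableEq A] [Fintype B] [DecidableEq B]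
    (ε : ℝ) (ρ : Matrix (A × B) (A × B) ℂ) : EReal :=
  ⨆ (σ : Matrix B B ℂ) (_ : IsState σ), condEntropyHRel ε ρ σ

/-- A randomized compression protocol for a source `X` with side information `B`, with seed `S`
and code book `M`: the seed is `s` with probability `prob s`, the encoder then is the function
`enc s`, and on the code word `m` the decoder measures `B` with the POVM `dec s m`, whose outcome
is the guess for `X`. -/
structure Protocol (X B S M : Type*) [Fintype X] [Fintype B] [DecidableEq B] [Fintype S] where
  prob : S → ℝ
  prob_nonneg : ∀ s, 0 ≤ prob s
  prob_sum : ∑ s, prob s = 1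
  enc : S → X → M
  dec : S → M → X → Matrix B B ℂ
  dec_posSemidef : ∀ s m x, (dec s m x).PosSemidef
  dec_sum : ∀ s m, ∑ x, dec s m x = 1

namespace Protocol

variable {X B S M : Type*} [Fintype X] [DecidableEq X] [Fintype B] [DecidableEq B]
  [Fintype S] [DecidableEq S] [Fintype M] [DecidableEq M]

/-- The initial state `ρ_XB ⊗ ∑ s, p s |ss⟩⟨ss|` on `(X, B)` and the two copies `(S, S')` of the
seed. -/
def initial (P : Protocol X B S M) (ρ : Matrix (X × B) (X × B) ℂ) :
    Matrix ((X × B) × (S × S)) ((X × B) × (S × S)) ℂ :=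
  ρ ⊗ₖ ∑ s, (P.prob s : ℂ) • Matrix.single (s, s) (s, s) (1 : ℂ)

/-- The encoding isometry `|x⟩|b⟩|s⟩|s'⟩ ↦ |x⟩|s⟩|enc s x⟩|b⟩|s'⟩`. Its output systems are
ordered as `((X, S), (M, (B, S')))`. -/
def encIsometry (P : Protocol X B S M) :
    Matrix ((X × S) × (M × (B × S))) ((X × B) × (S × S)) ℂ :=
  Matrix.of fun i j =>
    if i = ((j.1.1, j.2.1), (P.enc j.2.1 j.1.1, (j.1.2, j.2.2))) then 1 else 0

/-- The state `τ` of `((X, S), (M, (B, S')))` after the encoding. -/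
def encoded (P : Protocol X B S M) (ρ : Matrix (X × B) (X × B) ℂ) :
    Matrix ((X × S) × (M × (B × S))) ((X × S) × (M × (B × S))) ℂ :=
  P.encIsometry * P.initial ρ * P.encIsometry.conjTranspose

/-- The measurement operator `∑ m, |m⟩⟨m| ⊗ dec s m x ⊗ |s⟩⟨s|` on `(M, (B, S'))`. -/
def decOperator (P : Protocol X B S M) (x : X) (s : S) : Matrix (M × (B × S)) (M × (B × S)) ℂ :=
  ∑ m, Matrix.single m m (1 : ℂ) ⊗ₖ (P.dec s m x ⊗ₖ Matrix.single s s (1 : ℂ))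

/-- The final state `ω` of `((X, S), (X', S'))`, after the decoder has read out `S'` and `M` and
measured `B`. -/
def final (P : Protocol X B S M) (ρ : Matrix (X × B) (X × B) ℂ) :
    Matrix ((X × S) × (X × S)) ((X × S) × (X × S)) ℂ :=
  ∑ x, ∑ s, traceRight (((1 : Matrix (X × S) (X × S) ℂ) ⊗ₖ P.decOperator x s) * P.encoded ρ) ⊗ₖ
    (Matrix.single x x (1 : ℂ) ⊗ₖ Matrix.single s s (1 : ℂ))

/-- `Pr[X = x, X' = x', S = s]` in the final state. -/
def jointProb (P : Protocol X B S M) (ρ : Matrix (X × B) (X × B) ℂ) (x x' : X) (s : S) : ℝ :=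
  ∑ s', (P.final ρ ((x, s), (x', s')) ((x, s), (x', s'))).re

/-- The conditional error probability `Pr[X ≠ X' | S = s]` in the final state. -/
def condErr (P : Protocol X B S M) (ρ : Matrix (X × B) (X × B) ℂ) (s : S) : ℝ :=
  (∑ x, ∑ x', if x ≠ x' then P.jointProb ρ x x' s else 0) / ∑ x, ∑ x', P.jointProb ρ x x' s

/-- The error probability: the average over the seed of `Pr[X ≠ X' | S = s]`. A seed of
probability zero does not contribute. -/
def errProb (P : Protocol X B S M) (ρ : Matrix (X × B) (X × B) ℂ) : ℝ :=
  ∑ s, P.prob s * P.condErr ρ s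

end Protocol

/-- Compression to `m` bits with error at most `ε` is possible: there is a protocol, with some
finite seed set and a code book of `n` elements, where `log n ≤ m`. -/
def Compressible {X B : Type*} [Fintype X] [DecidableEq X] [Fintype B] [DecidableEq B]
    (ε : ℝ) (ρ : Matrix (X × B) (X × B) ℂ) (m : ℕ) : Prop :=
  ∃ (k n : ℕ) (P : Protocol X B (Fin k) (Fin n)), Real.logb 2 n ≤ m ∧ P.errProb ρ ≤ ε

/-- The minimal compression length `m^ε(X|B)_ρ` in bits, as an extended real number (it would be
`∞` if no length were possible). -/
def minCompressionLength {X B : Type*} [Fintype X] [DecidableEq X] [Fintype B] [DecidableEq B]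
    (ε : ℝ) (ρ : Matrix (X × B) (X × B) ℂ) : EReal :=
  ⨅ (m : ℕ) (_ : Compressible ε ρ m), ((m : ℝ) : EReal)

end SourceCompression

end

open scoped Kronecker BigOperators ComplexOrder

noncomputable section

namespace SourceCompression

set_option linter.unusedSectionVars false

open Matrix

/-! ### The real trace pairing and its positivity. -/

section HSInner

variable {A : Type*} [Fintype A]

/-! Since ρ is block diagonal over `X`, a test Q pairs with ρ and with 1 ⊗ σ only through its
diagonal blocks Q_x (`hsInner_eq_sum_block`, `hsInner_one_kronecker`). Protocols and tests are thus
compared block by block.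

Lower bound: a protocol gives the test with blocks ∑_s p_s M_x^{s,e_s(x)}. It accepts ρ with
probability 1 - p_err, and its value on 1 ⊗ σ is at most |M|, since each code word has a POVM of
total weight one (`Compressible.exists_test`).

Upper bound: the seed is a uniformly random function f : X → M, used as encoder. Given m, the
decoder applies the square-root measurement built from the blocks Q_x with f x = m. The
Hayashi–Nagaoka inequality (`hayashi_nagaoka`) bounds its error by (1 + c) times the missed weight
of Q plus (2 + c + 1/c) times the weight of the colliding symbols. Two symbols collide with
probability 1/|M|, so on average the second term is controlled by tr Q(1 ⊗ ρ_B)/|M|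
(`exists_protocol`). It remains to choose c and round |M| to a power of two. -/

lemma hsInner_add_left (K L M : Matrix A A ℂ) :
    hsInner (K + L) M = hsInner K M + hsInner L M := by
  simp [hsInner, Matrix.add_mul]

lemma hsInner_sub_left (K L M : Matrix A A ℂ) :
    hsInner (K - L) M = hsInner K M - hsInner L M := by
  simp [hsInner, Matrix.sub_mul]

lemma hsInner_smul_left (c : ℝ) (L M : Matrix A A ℂ) :
    hsInner (c • L) M = c * hsInner L M := by
  simp [hsInner]

lemma hsInner_sum_left {ι : Type*} (s : Finset ι) (L : ι → Matrix A A ℂ) (M : Matrix A A ℂ) :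
    hsInner (∑ i ∈ s, L i) M = ∑ i ∈ s, hsInner (L i) M := by
  simp [hsInner, Matrix.conjTranspose_sum, Finset.sum_mul, Matrix.trace_sum]

lemma hsInner_sum_right {ι : Type*} (s : Finset ι) (L : Matrix A A ℂ) (M : ι → Matrix A A ℂ) :
    hsInner L (∑ i ∈ s, M i) = ∑ i ∈ s, hsInner L (M i) := by
  simp [hsInner, Finset.mul_sum, Matrix.trace_sum]

lemma hsInner_one_left [DecidableEq A] (M : Matrix A A ℂ) : hsInner 1 M = M.trace.re := by
  simp [hsInner]

open scoped MatrixOrder Matrix.Norms.L2Operator in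
lemma hsInner_nonneg {L M : Matrix A A ℂ} (hL : L.PosSemidef) (hM : M.PosSemidef) :
    0 ≤ hsInner L M := by
  classical
  obtain ⟨K, rfl⟩ := CStarAlgebra.nonneg_iff_eq_star_mul_self.mp hM.nonneg
  have h := (hL.mul_mul_conjTranspose_same K).trace_nonneg
  rw [hsInner, hL.1.eq, Matrix.star_eq_conjTranspose, ← Matrix.mul_assoc,
    Matrix.trace_mul_comm, ← Matrix.mul_assoc]
  exact (Complex.le_def.mp h).1

lemma hsInner_le_of_posSemidef_sub {K L M : Matrix A A ℂ} (h : (L - K).PosSemidef)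
    (hM : M.PosSemidef) : hsInner K M ≤ hsInner L M := by
  have := hsInner_nonneg h hM
  rw [hsInner_sub_left] at this
  linarith

end HSInner

/-! ### Reduction to diagonal blocks. -/

section Block

variable {X B : Type*}

/-- The diagonal block of an operator on `X ⊗ B` at the basis vector `x` of `X`. -/
def block (L : Matrix (X × B) (X × B) ℂ) (x : X) : Matrix B B ℂ :=
  L.submatrix (Prod.mk x) (Prod.mk x)

lemma block_posSemidef {L : Matrix (X × B) (X × B) ℂ} (hL : L.PosSemidef) (x : X) :
    (block L x).PosSemidef := hL.submatrix _

lemma one_sub_block_posSemidef [DecidableEq X] [DecidableEq B] {L : Matrix (X × B) (X × B) ℂ}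
    (hL : (1 - L).PosSemidef) (x : X) : (1 - block L x).PosSemidef := by
  have h := block_posSemidef hL x
  have e : block (1 - L) x = 1 - block L x := by
    ext b b'
    simp [block, Matrix.one_apply]
  rwa [e] at h

variable [Fintype X] [DecidableEq X] [Fintype B]

lemma IsCQState.apply_of_ne {ρ : Matrix (X × B) (X × B) ℂ} (hρ : IsCQState ρ) {x y : X}
    (hxy : x ≠ y) (b c : B) : ρ (x, b) (y, c) = 0 := by
  obtain ⟨p, φ, -, -, -, rfl⟩ := hρ
  simp only [Matrix.sum_apply, Matrix.smul_apply, Matrix.kroneckerMap_apply, Matrix.single_apply]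
  refine Finset.sum_eq_zero fun z _ => ?_
  have : ¬(z = x ∧ z = y) := fun h => hxy (h.1.symm.trans h.2)
  simp [this]

lemma IsCQState.exists_block {ρ : Matrix (X × B) (X × B) ℂ} (hρ : IsCQState ρ) :
    (∀ x, (block ρ x).PosSemidef) ∧ ∑ x, (block ρ x).trace.re = 1 := by
  obtain ⟨p, φ, hp, hp1, hφ, rfl⟩ := hρ
  have key : ∀ x, block (∑ x, (p x : ℂ) • (Matrix.single x x (1 : ℂ) ⊗ₖ φ x)) x
      = (p x : ℂ) • φ x := by
    intro x
    ext b c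
    simp [block, Matrix.sum_apply, Matrix.single_apply]
  simp only [key]
  refine ⟨fun x => (hφ x).1.smul (by exact_mod_cast hp x), ?_⟩
  simpa [Matrix.trace_smul, (hφ _).2] using hp1

lemma traceLeft_eq_sum_block (L : Matrix (X × B) (X × B) ℂ) : traceLeft L = ∑ x, block L x := by
  ext b c
  simp [traceLeft, block, Matrix.sum_apply]

lemma hsInner_eq_sum_block {ρ : Matrix (X × B) (X × B) ℂ} (hρ : IsCQState ρ)
    (Q : Matrix (X × B) (X × B) ℂ) : hsInner Q ρ = ∑ x, hsInner (block Q x) (block ρ x) := by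
  simp only [hsInner, Matrix.trace, Matrix.diag, Matrix.mul_apply, Fintype.sum_prod_type,
    ← Complex.re_sum, block, Matrix.conjTranspose_apply, Matrix.submatrix_apply]
  congr 1
  refine Finset.sum_congr rfl fun x _ => Finset.sum_congr rfl fun b _ => ?_
  rw [Finset.sum_eq_single x _ (by simp)]
  intro y _ hy
  simp [hρ.apply_of_ne hy]

lemma hsInner_one_kronecker (Q : Matrix (X × B) (X × B) ℂ) (σ : Matrix B B ℂ) :
    hsInner Q ((1 : Matrix X X ℂ) ⊗ₖ σ) = ∑ x, hsInner (block Q x) σ := by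
  simp only [hsInner, Matrix.trace, Matrix.diag, Matrix.mul_apply, Fintype.sum_prod_type,
    ← Complex.re_sum, block, Matrix.conjTranspose_apply, Matrix.submatrix_apply,
    Matrix.kroneckerMap_apply]
  congr 1
  refine Finset.sum_congr rfl fun x _ => Finset.sum_congr rfl fun b _ => ?_
  rw [Finset.sum_eq_single x _ (by simp)]
  · simp
  intro y _ hy
  simp [hy]

end Block

/-! ### The protocol's joint outcome distribution. -/

namespace Protocol

variable {X B S M : Type*} [Fintype X] [DecidableEq X] [Fintype B] [DecidableEq B]
  [Fintype S] [DecidableEq S] [Fintype M] [DecidableEq M]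

lemma initial_apply (P : Protocol X B S M) (ρ : Matrix (X × B) (X × B) ℂ) (i j : X × B)
    (s s' t t' : S) : P.initial ρ (i, (s, s')) (j, (t, t')) =
      if s = s' ∧ t = t' ∧ s = t then ρ i j * P.prob s else 0 := by
  simp only [initial, Matrix.kroneckerMap_apply, Matrix.sum_apply, Matrix.smul_apply,
    Matrix.single_apply, Prod.mk.injEq, smul_eq_mul]
  split_ifs with h
  · obtain ⟨rfl, rfl, rfl⟩ := h
    simp
  · rw [Finset.sum_eq_zero, mul_zero]
    intro r _
    rw [if_neg, mul_zero]
    rintro ⟨⟨rfl, rfl⟩, rfl, rfl⟩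
    simp at h

lemma encoded_apply (P : Protocol X B S M) (ρ : Matrix (X × B) (X × B) ℂ) (x y : X) (s t : S)
    (m n : M) (b c : B) (s' t' : S) :
    P.encoded ρ ((x, s), (m, (b, s'))) ((y, t), (n, (c, t'))) =
      if m = P.enc s x ∧ n = P.enc t y then P.initial ρ ((x, b), (s, s')) ((y, c), (t, t'))
      else 0 := by
  have e : ∀ (x : X) (s : S) (m : M) (b : B) (s' : S) (j : (X × B) × (S × S)),
      P.encIsometry ((x, s), (m, (b, s'))) j =
        if j = ((x, b), (s, s')) then (if m = P.enc s x then 1 else 0) else 0 := by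
    rintro x s m b s' ⟨⟨x₁, b₁⟩, s₁, t₁⟩
    simp only [encIsometry, Matrix.of_apply, Prod.mk.injEq]
    rw [← ite_and]
    refine if_congr ?_ rfl rfl
    constructor
    · rintro ⟨⟨rfl, rfl⟩, rfl, rfl, rfl⟩
      simp
    · rintro ⟨⟨⟨rfl, rfl⟩, rfl, rfl⟩, rfl⟩
      simp
  simp only [encoded, Matrix.mul_apply, Matrix.conjTranspose_apply, e]
  simp only [ite_mul, zero_mul, apply_ite star, star_one, star_zero, mul_ite, mul_zero, mul_one,
    one_mul, Finset.sum_ite_eq', Finset.mem_univ, if_true, ite_and]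
  split_ifs <;> simp

lemma decOperator_apply (P : Protocol X B S M) (x : X) (s : S) (m n : M) (b c : B) (t t' : S) :
    P.decOperator x s (m, (b, t)) (n, (c, t')) =
      if m = n ∧ s = t ∧ s = t' then P.dec s m x b c else 0 := by
  simp only [decOperator, Matrix.sum_apply, Matrix.kroneckerMap_apply, Matrix.single_apply]
  rw [Finset.sum_eq_single m _ (by simp)]
  · simp only [true_and, ite_and, ite_mul, one_mul, zero_mul, mul_ite, mul_one, mul_zero]
    split_ifs <;> rfl
  · intro k _ hk
    simp [hk]

/-- The isometries, seed copies and partial traces collapse to the Born rule; `block ρ x` is the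
unnormalized state p_x φ^x, so it carries the source probability. -/
lemma jointProb_eq (P : Protocol X B S M) (ρ : Matrix (X × B) (X × B) ℂ) (x x' : X) (s : S) :
    P.jointProb ρ x x' s = P.prob s * hsInner (P.dec s (P.enc s x) x') (block ρ x) := by
  have h1 : ∀ s', P.final ρ ((x, s), (x', s')) ((x, s), (x', s')) =
      traceRight (((1 : Matrix (X × S) (X × S) ℂ) ⊗ₖ P.decOperator x' s') * P.encoded ρ)
        (x, s) (x, s) := by
    intro s'
    simp only [final, Matrix.sum_apply, Matrix.kroneckerMap_apply, Matrix.single_apply]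
    rw [Finset.sum_eq_single x' _ (by simp), Finset.sum_eq_single s' _ (by simp)]
    · simp
    · intro t _ ht
      simp [ht]
    · intro y _ hy
      simp [hy]
  have h2 : ∀ s', traceRight (((1 : Matrix (X × S) (X × S) ℂ) ⊗ₖ P.decOperator x' s') *
      P.encoded ρ) (x, s) (x, s) = if s' = s then
        (P.prob s : ℂ) * (P.dec s (P.enc s x) x' * block ρ x).trace else 0 := by
    intro s'
    have : ∀ (i : X × S) (k l : M × (B × S)),
        ((1 : Matrix (X × S) (X × S) ℂ) ⊗ₖ P.decOperator x' s') ((x, s), k) (i, l) =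
          if i = (x, s) then P.decOperator x' s' k l else 0 := by
      intro i k l
      simp [Matrix.kroneckerMap_apply, Matrix.one_apply, eq_comm]
    simp only [traceRight, Matrix.of_apply, Matrix.mul_apply]
    simp only [Fintype.sum_prod_type (α₁ := X × S)]
    simp only [this, ite_mul, zero_mul]
    simp only [Finset.sum_ite_irrel, Finset.sum_const_zero, Finset.sum_ite_eq', Finset.mem_univ,
      if_true]
    simp only [Fintype.sum_prod_type, decOperator_apply, encoded_apply, initial_apply, ite_and,
      ite_mul, zero_mul, mul_ite, mul_zero, Finset.sum_ite_irrel, Finset.sum_const_zero,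
      Finset.sum_ite_eq', Finset.sum_ite_eq, Finset.mem_univ, if_true]
    by_cases hs : s' = s
    · subst hs
      simp only [if_true, Matrix.trace, Matrix.diag, Matrix.mul_apply, Finset.mul_sum, block,
        Matrix.submatrix_apply]
      exact Finset.sum_congr rfl fun b _ => Finset.sum_congr rfl fun c _ => by ring
    · simp [hs]
  simp only [jointProb, h1, h2]
  rw [Finset.sum_eq_single s _ (by simp)]
  · simp [hsInner, (P.dec_posSemidef s (P.enc s x) x').1.eq]
  · intro t _ ht
    simp [ht]

end Protocol

/-! ### The Hayashi–Nagaoka inequality. -/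

section HayashiNagaoka

variable {B : Type*} [Fintype B] [DecidableEq B]

open scoped MatrixOrder Matrix.Norms.L2Operator in
-- Operator monotonicity of the square root.
lemma posSemidef_sub_of_posSemidef_sq_sub {R S : Matrix B B ℂ} (hR : R.PosSemidef)
    (hS : S.PosSemidef) (h : (R * R - S * S).PosSemidef) : (R - S).PosSemidef := by
  have hle : S * S ≤ R * R := Matrix.le_iff.mpr h
  have := CFC.sqrt_le_sqrt _ _ hle
  rw [CFC.sqrt_mul_self S hS.nonneg, CFC.sqrt_mul_self R hR.nonneg] at this
  exact Matrix.le_iff.mp this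

open scoped MatrixOrder Matrix.Norms.L2Operator in
lemma exists_sqrt_inverse {G : Matrix B B ℂ} (hG : G.PosDef) :
    ∃ R W : Matrix B B ℂ, R.PosSemidef ∧ W.IsHermitian ∧ R * R = G ∧ W * R = 1 ∧ R * W = 1 := by
  have hR : (CFC.sqrt G).PosSemidef := Matrix.nonneg_iff_posSemidef.mp (CFC.sqrt_nonneg G)
  have hsq : CFC.sqrt G * CFC.sqrt G = G := CFC.sqrt_mul_sqrt_self G hG.posSemidef.nonneg
  have hdet : IsUnit (CFC.sqrt G).det := by
    have h := hG.det_pos.ne'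
    rw [← hsq, Matrix.det_mul] at h
    exact (left_ne_zero_of_mul h).isUnit
  exact ⟨CFC.sqrt G, (CFC.sqrt G)⁻¹, hR, hR.1.inv, hsq, Matrix.nonsing_inv_mul _ hdet,
    Matrix.mul_nonsing_inv _ hdet⟩

/-- The Hayashi–Nagaoka inequality, for an invertible `S + T` with square root `R`. -/
lemma hayashi_nagaoka {S T R W : Matrix B B ℂ} (hS : S.PosSemidef) (hS1 : (1 - S).PosSemidef)
    (hT : T.PosSemidef) (hR : R.PosSemidef) (hW : W.IsHermitian) (hRR : R * R = S + T)
    (hWR : W * R = 1) (hRW : R * W = 1) {c : ℝ} (hc : 0 < c) :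
    (((1 + c) • (1 - S) + (2 + c + c⁻¹) • T) - (1 - W * S * W)).PosSemidef := by
  have conj : ∀ {K L : Matrix B B ℂ}, K.IsHermitian → L.PosSemidef → (K * L * K).PosSemidef := by
    intro K L hK hL
    simpa [hK.eq] using hL.mul_mul_conjTranspose_same K
  have h1 : (1 : Matrix B B ℂ).IsHermitian := Matrix.isHermitian_one
  -- S - S² = S(1 - S)S + (1 - S)S(1 - S).
  have hSS : (S - S * S).PosSemidef := by
    have := (conj hS.1 hS1).add (conj hS1.1 hS)
    convert this using 1
    noncomm_ring
  -- S² ≤ S ≤ S + T = R², then take square roots.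
  have hRS : (R - S).PosSemidef := by
    refine posSemidef_sub_of_posSemidef_sq_sub hR hS ?_
    convert hSS.add hT using 1
    rw [hRR]; abel
  have hW1 : (W - 1).IsHermitian := hW.sub h1
  have hK : (c • (W - 1) - 1 : Matrix B B ℂ).IsHermitian := by
    refine Matrix.IsHermitian.sub ?_ h1
    rw [Matrix.IsHermitian, Matrix.conjTranspose_smul, hW1.eq]
    simp
  -- With K = c(W - 1) - 1, the claimed difference equals c⁻¹ K T K + (1 + c)(2(R - S) + (W - 1)S(W
  -- - 1)), a sum of positive terms. The rest verifies this identity by eliminating T = R² - S from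
  -- the products with W = R⁻¹.
  have hpos := ((conj hK hT).smul (inv_pos.mpr hc).le).add
    (((hRS.smul zero_le_two (α := ℝ)).add (conj hW1 hS)).smul (by positivity : 0 ≤ 1 + c))
  convert hpos using 1
  have eST : T = R * R - S := by rw [hRR]; abel
  have e1 : W * R * R * W = 1 := by rw [hWR, Matrix.one_mul, hRW]
  have e2 : W * R * R = R := by rw [hWR, Matrix.one_mul]
  have e3 : R * R * W = R := by rw [Matrix.mul_assoc, hRW, Matrix.mul_one]
  have f1 : W * T * W = 1 - W * S * W := by
    rw [eST, ← e1]; noncomm_ring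
  have f2 : W * T = R - W * S := by
    rw [eST, Matrix.mul_sub, ← Matrix.mul_assoc, e2]
  have f3 : T * W = R - S * W := by
    rw [eST, Matrix.sub_mul, e3]
  have g1 : (c • (W - 1) - 1) * T * (c • (W - 1) - 1) =
      (c * c) • (W * T * W) - (c * c + c) • (W * T + T * W) + ((1 + c) * (1 + c)) • T := by
    simp only [Matrix.sub_mul, Matrix.mul_sub, Matrix.smul_mul, Matrix.mul_smul, Matrix.one_mul,
      Matrix.mul_one]
    module
  have g2 : (W - 1) * S * (W - 1) = W * S * W - W * S - S * W + S := by
    noncomm_ring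
  rw [g1, g2, f1, f2, f3]
  match_scalars <;> field_simp <;> ring

end HayashiNagaoka

/-! ### Collision count and the error formula. -/

/-- Once f is fixed away from x, exactly one of the n values at x collides with f y. -/
lemma card_mul_sum_collision {X : Type*} [Fintype X] [DecidableEq X] {n : ℕ} {x y : X}
    (hxy : y ≠ x) : (n : ℝ) * ∑ f : X → Fin n, (if f y = f x then (1 : ℝ) else 0) =
      Fintype.card (X → Fin n) := by
  have e := Fintype.card_congr (Equiv.funSplitAt x (Fin n))
  rw [e, Fintype.card_prod, Fintype.card_fin, Nat.cast_mul]
  congr 1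
  rw [Fintype.sum_equiv (Equiv.funSplitAt x (Fin n)) _
    (fun q => if q.2 ⟨y, hxy⟩ = q.1 then (1 : ℝ) else 0) (fun f => by simp),
    Fintype.sum_prod_type_right]
  simp

lemma Protocol.errProb_eq {X B S M : Type*} [Fintype X] [DecidableEq X] [Fintype B]
    [DecidableEq B] [Fintype S] [DecidableEq S] [Fintype M] [DecidableEq M]
    (P : Protocol X B S M) {ρ : Matrix (X × B) (X × B) ℂ} (hρ : IsCQState ρ) :
    P.errProb ρ =
      1 - ∑ s, P.prob s * ∑ x, hsInner (P.dec s (P.enc s x) x) (block ρ x) := by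
  have hrow : ∀ x s, ∑ x', P.jointProb ρ x x' s = P.prob s * (block ρ x).trace.re := by
    intro x s
    simp only [P.jointProb_eq, ← Finset.mul_sum]
    rw [← hsInner_sum_left, P.dec_sum, hsInner_one_left]
  have htot : ∀ s, ∑ x, ∑ x', P.jointProb ρ x x' s = P.prob s := by
    intro s
    simp only [hrow, ← Finset.mul_sum, hρ.exists_block.2, mul_one]
  have herr : ∀ s, P.prob s * P.condErr ρ s = P.prob s -
      P.prob s * ∑ x, hsInner (P.dec s (P.enc s x) x) (block ρ x) := by
    intro s
    rcases eq_or_ne (P.prob s) 0 with h0 | h0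
    · simp [h0]
    have hnum : ∑ x, ∑ x', (if x ≠ x' then P.jointProb ρ x x' s else 0) =
        P.prob s - ∑ x, P.jointProb ρ x x s := by
      rw [← htot s, ← Finset.sum_sub_distrib]
      refine Finset.sum_congr rfl fun x _ => ?_
      rw [eq_sub_iff_add_eq, ← Finset.sum_erase_add _ _ (Finset.mem_univ x),
        ← Finset.sum_erase_add _ (fun x' => P.jointProb ρ x x' s) (Finset.mem_univ x)]
      simp only [ne_eq, not_true_eq_false, if_false, add_zero]
      congr 1
      refine Finset.sum_congr rfl fun y hy => ?_
      rw [if_pos (Finset.ne_of_mem_erase hy).symm]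
    rw [condErr, hnum, htot, mul_div_cancel₀ _ h0]
    simp only [P.jointProb_eq, Finset.mul_sum]
  simp only [errProb, herr, Finset.sum_sub_distrib, P.prob_sum]

/-! ### Converse, random coding, and the final bounds. -/

section BlockDiag

variable {X B : Type*} [Fintype X] [DecidableEq X] [Fintype B] [DecidableEq B]

/-- The operator `∑ x, |x⟩⟨x| ⊗ D x`. -/
def cqOperator (D : X → Matrix B B ℂ) : Matrix (X × B) (X × B) ℂ :=
  ∑ x, Matrix.single x x (1 : ℂ) ⊗ₖ D x

lemma block_cqOperator (D : X → Matrix B B ℂ) (x : X) : block (cqOperator D) x = D x := by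
  ext b c
  simp [block, cqOperator, Matrix.sum_apply, Matrix.single_apply]

lemma cqOperator_posSemidef {D : X → Matrix B B ℂ} (hD : ∀ x, (D x).PosSemidef) :
    (cqOperator D).PosSemidef := by
  refine Matrix.posSemidef_sum _ fun x _ => Matrix.PosSemidef.kronecker ?_ (hD x)
  rw [← Matrix.diagonal_single]
  refine Matrix.PosSemidef.diagonal fun y => ?_
  rcases eq_or_ne y x with rfl | h
  · simp
  · simp [h]

lemma one_sub_cqOperator (D : X → Matrix B B ℂ) :
    1 - cqOperator D = cqOperator fun x => 1 - D x := by
  ext ⟨x, b⟩ ⟨y, c⟩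
  rcases eq_or_ne x y with rfl | h
  · simp [cqOperator, Matrix.sum_apply, Matrix.single_apply, Matrix.one_apply]
  · have : ∀ z, ¬(z = x ∧ z = y) := fun z hz => h (hz.1.symm.trans hz.2)
    simp [cqOperator, Matrix.sum_apply, Matrix.one_apply, h, this]

lemma Compressible.exists_test {ρ : Matrix (X × B) (X × B) ℂ} (hρ : IsCQState ρ) {ε : ℝ} {m : ℕ}
    (h : Compressible ε ρ m) {σ : Matrix B B ℂ} (hσ : IsState σ) :
    ∃ Q, IsTest ε ρ Q ∧ hsInner Q ((1 : Matrix X X ℂ) ⊗ₖ σ) ≤ 2 ^ m := by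
  obtain ⟨k, n, P, hn, hP⟩ := h
  have hpsd : ∀ s x, (P.prob s • P.dec s (P.enc s x) x).PosSemidef := fun s x =>
    (P.dec_posSemidef _ _ _).smul (P.prob_nonneg s)
  refine ⟨cqOperator fun x => ∑ s, P.prob s • P.dec s (P.enc s x) x, ⟨?_, ?_, ?_⟩, ?_⟩
  · exact cqOperator_posSemidef fun x => Matrix.posSemidef_sum _ fun s _ => hpsd s x
  · rw [one_sub_cqOperator]
    refine cqOperator_posSemidef fun x => ?_
    -- The complement is the averaged weight of the wrong outcomes.
    have e : 1 - ∑ s, P.prob s • P.dec s (P.enc s x) x =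
        ∑ s, P.prob s • ∑ y ∈ Finset.univ.erase x, P.dec s (P.enc s x) y := by
      have : ∀ s, ∑ y ∈ Finset.univ.erase x, P.dec s (P.enc s x) y =
          1 - P.dec s (P.enc s x) x := fun s => by
        rw [eq_sub_iff_add_eq, Finset.sum_erase_add _ _ (Finset.mem_univ x), P.dec_sum]
      simp only [this, smul_sub, Finset.sum_sub_distrib, ← Finset.sum_smul, P.prob_sum, one_smul]
    rw [e]
    exact Matrix.posSemidef_sum _ fun s _ => (Matrix.posSemidef_sum _ fun y _ =>
      P.dec_posSemidef _ _ _).smul (P.prob_nonneg s)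
  · rw [hsInner_eq_sum_block hρ]
    simp only [block_cqOperator, hsInner_sum_left, hsInner_smul_left]
    rw [Finset.sum_comm]
    simp only [← Finset.mul_sum]
    rw [P.errProb_eq hρ] at hP
    linarith
  · rw [hsInner_one_kronecker]
    simp only [block_cqOperator, hsInner_sum_left, hsInner_smul_left]
    rw [Finset.sum_comm]
    simp only [← Finset.mul_sum]
    have hle : ∀ s, ∑ x, hsInner (P.dec s (P.enc s x) x) σ ≤ n := by
      intro s
      calc ∑ x, hsInner (P.dec s (P.enc s x) x) σ
          ≤ ∑ x, ∑ c, hsInner (P.dec s c x) σ := Finset.sum_le_sum fun x _ =>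
            Finset.single_le_sum (f := fun c => hsInner (P.dec s c x) σ)
              (fun c _ => hsInner_nonneg (P.dec_posSemidef s c x) hσ.1) (Finset.mem_univ _)
        _ = n := by
            rw [Finset.sum_comm]
            simp only [← hsInner_sum_left, P.dec_sum, hsInner_one_left, hσ.2]
            simp
    have hn2 : (n : ℝ) ≤ 2 ^ m := by
      -- An empty code book has `Real.logb 2 0 = 0`, so the logarithmic bound is usable only for n >
      -- 0.
      rcases Nat.eq_zero_or_pos n with rfl | hn0
      · simp
      · rw [Real.logb_le_iff_le_rpow one_lt_two (by exact_mod_cast hn0)] at hn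
        exact_mod_cast hn
    refine le_trans ?_ hn2
    calc ∑ s, P.prob s * ∑ x, hsInner (P.dec s (P.enc s x) x) σ
        ≤ ∑ s, P.prob s * n := Finset.sum_le_sum fun s _ =>
          mul_le_mul_of_nonneg_left (hle s) (P.prob_nonneg s)
      _ = n := by rw [← Finset.sum_mul, P.prob_sum, one_mul]

/-- Square-root measurement for the candidates in `s`. The term δ • 1 makes the sum invertible, so
that no pseudo-inverse is needed, and its share of the outcomes is credited to an arbitrary symbol
x₀ to complete the POVM. This can only enlarge D x. -/
lemma exists_decoder {Λ : X → Matrix B B ℂ} (hΛ : ∀ x, (Λ x).PosSemidef)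
    (hΛ1 : ∀ x, (1 - Λ x).PosSemidef) [Nonempty X] (s : Finset X) {c δ : ℝ} (hc : 0 < c)
    (hδ : 0 < δ) : ∃ D : X → Matrix B B ℂ, (∀ x, (D x).PosSemidef) ∧ ∑ x, D x = 1 ∧
      ∀ x ∈ s, (((1 + c) • (1 - Λ x) + (2 + c + c⁻¹) • (∑ y ∈ s.erase x, Λ y + δ • 1)) -
        (1 - D x)).PosSemidef := by
  obtain ⟨x₀⟩ := ‹Nonempty X›
  have hδ1 : (δ • (1 : Matrix B B ℂ)).PosDef := Matrix.PosDef.one.smul hδ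
  have hG : (∑ y ∈ s, Λ y + δ • (1 : Matrix B B ℂ)).PosDef :=
    Matrix.PosDef.posSemidef_add (Matrix.posSemidef_sum _ fun y _ => hΛ y) hδ1
  obtain ⟨R, W, hR, hW, hRR, hWR, hRW⟩ := exists_sqrt_inverse hG
  have conj : ∀ {L : Matrix B B ℂ}, L.PosSemidef → (W * L * W).PosSemidef := by
    intro L hL
    simpa [hW.eq] using hL.mul_mul_conjTranspose_same W
  have hrest : ∀ x, (if x = x₀ then δ • (1 : Matrix B B ℂ) else 0).PosSemidef := by
    intro x
    split_ifs
    · exact hδ1.posSemidef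
    · exact Matrix.PosSemidef.zero
  refine ⟨fun x => W * ((if x ∈ s then Λ x else 0) + if x = x₀ then δ • 1 else 0) * W,
    fun x => conj (Matrix.PosSemidef.add ?_ (hrest x)), ?_, fun x hx => ?_⟩
  · split_ifs
    · exact hΛ x
    · exact Matrix.PosSemidef.zero
  · rw [← Finset.sum_mul, ← Finset.mul_sum, Finset.sum_add_distrib, Finset.sum_ite_mem,
      Finset.univ_inter, Finset.sum_ite_eq', if_pos (Finset.mem_univ _), ← hRR,
      ← Matrix.mul_assoc, hWR, Matrix.one_mul, hRW]
  · have hT : (∑ y ∈ s.erase x, Λ y + δ • (1 : Matrix B B ℂ)).PosSemidef :=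
      (Matrix.posSemidef_sum _ fun y _ => hΛ y).add hδ1.posSemidef
    have hsum : R * R = Λ x + (∑ y ∈ s.erase x, Λ y + δ • (1 : Matrix B B ℂ)) := by
      rw [hRR, ← add_assoc, Finset.add_sum_erase _ _ hx]
    have := (hayashi_nagaoka (hΛ x) (hΛ1 x) hT hR hW hsum hWR hRW hc).add (conj (hrest x))
    convert this using 1
    simp only [if_pos hx, Matrix.mul_add, Matrix.add_mul]
    abel

lemma exists_protocol {ρ : Matrix (X × B) (X × B) ℂ} (hρ : IsCQState ρ)
    {Q : Matrix (X × B) (X × B) ℂ} (hQ : Q.PosSemidef) (hQ1 : (1 - Q).PosSemidef) {n : ℕ}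
    (hn : 0 < n) {c δ : ℝ} (hc : 0 < c) (hδ : 0 < δ) :
    ∃ (k : ℕ) (P : Protocol X B (Fin k) (Fin n)), P.errProb ρ ≤ (1 + c) * (1 - hsInner Q ρ) +
      (2 + c + c⁻¹) * (hsInner Q ((1 : Matrix X X ℂ) ⊗ₖ traceLeft ρ) / n + δ) := by
  have hb := hρ.exists_block
  have : Nonempty X := by
    by_contra h
    rw [not_nonempty_iff] at h
    simpa using hb.2
  have : Nonempty (Fin n) := ⟨⟨0, hn⟩⟩
  choose D hD hD1 hDle using fun (f : X → Fin n) (j : Fin n) =>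
    exists_decoder (block_posSemidef hQ) (one_sub_block_posSemidef hQ1)
      (Finset.univ.filter fun x => f x = j) hc hδ
  let e := (Fintype.equivFin (X → Fin n)).symm
  obtain ⟨N, hN⟩ : ∃ N : ℝ, N = ((Fintype.card (X → Fin n) : ℕ) : ℝ) := ⟨_, rfl⟩
  have hN0 : 0 < N := by rw [hN]; exact_mod_cast Fintype.card_pos
  have hn0 : (0 : ℝ) < n := by exact_mod_cast hn
  let P : Protocol X B (Fin (Fintype.card (X → Fin n))) (Fin n) :=
    { prob := fun _ => N⁻¹
      prob_nonneg := fun _ => inv_nonneg.mpr hN0.le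
      prob_sum := by
        rw [Finset.sum_const, Finset.card_univ, Fintype.card_fin, nsmul_eq_mul, ← hN,
          mul_inv_cancel₀ hN0.ne']
      enc := fun s => e s
      dec := fun s => D (e s)
      dec_posSemidef := fun s => hD (e s)
      dec_sum := fun s => hD1 (e s) }
  refine ⟨_, P, ?_⟩
  have herr : P.errProb ρ = ∑ f : X → Fin n, N⁻¹ * ∑ x, hsInner (1 - D f (f x) x) (block ρ x) := by
    rw [P.errProb_eq hρ, ← Equiv.sum_comp e]
    simp only [hsInner_sub_left, Finset.sum_sub_distrib, hsInner_one_left, hb.2, mul_sub, mul_one]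
    rw [P.prob_sum]
  have hcode : ∀ (f : X → Fin n) (x : X), hsInner (1 - D f (f x) x) (block ρ x) ≤
      (1 + c) * hsInner (1 - block Q x) (block ρ x) + (2 + c + c⁻¹) *
        (∑ y ∈ Finset.univ.erase x, (if f y = f x then 1 else 0) *
          hsInner (block Q y) (block ρ x) + δ * (block ρ x).trace.re) := by
    intro f x
    refine (hsInner_le_of_posSemidef_sub (hDle f (f x) x (by simp)) (hb.1 x)).trans_eq ?_
    simp only [hsInner_add_left, hsInner_smul_left, hsInner_sum_left, hsInner_one_left]
    rw [← Finset.filter_erase, Finset.sum_filter]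
    simp only [ite_mul, one_mul, zero_mul]
  have hcoll : ∀ x, ∀ y ∈ Finset.univ.erase x,
      N⁻¹ * ∑ f : X → Fin n, (if f y = f x then (1 : ℝ) else 0) = (n : ℝ)⁻¹ := by
    intro x y hy
    have h := card_mul_sum_collision (n := n) (Finset.ne_of_mem_erase hy)
    rw [← hN] at h
    field_simp
    linarith
  -- Restoring the diagonal terms y = x completes ∑_x ρ_x to ρ_B.
  have hcross : ∑ x, ∑ y ∈ Finset.univ.erase x, hsInner (block Q y) (block ρ x) ≤
      hsInner Q ((1 : Matrix X X ℂ) ⊗ₖ traceLeft ρ) := by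
    rw [hsInner_one_kronecker, traceLeft_eq_sum_block]
    simp only [hsInner_sum_right]
    rw [Finset.sum_comm]
    refine Finset.sum_le_sum fun x _ => ?_
    refine Finset.sum_le_sum_of_subset_of_nonneg (Finset.erase_subset _ _) fun y _ _ => ?_
    exact hsInner_nonneg (block_posSemidef hQ y) (hb.1 x)
  rw [herr]
  calc ∑ f : X → Fin n, N⁻¹ * ∑ x, hsInner (1 - D f (f x) x) (block ρ x)
      ≤ ∑ f : X → Fin n, N⁻¹ * ∑ x, ((1 + c) * hsInner (1 - block Q x) (block ρ x) +
        (2 + c + c⁻¹) * (∑ y ∈ Finset.univ.erase x, (if f y = f x then 1 else 0) *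
          hsInner (block Q y) (block ρ x) + δ * (block ρ x).trace.re)) :=
        Finset.sum_le_sum fun f _ => mul_le_mul_of_nonneg_left
          (Finset.sum_le_sum fun x _ => hcode f x) (inv_nonneg.mpr hN0.le)
    _ = (1 + c) * (1 - hsInner Q ρ) + (2 + c + c⁻¹) *
        ((∑ x, ∑ y ∈ Finset.univ.erase x, hsInner (block Q y) (block ρ x)) * (n : ℝ)⁻¹ + δ) := by
        have h1 : ∑ x, hsInner (1 - block Q x) (block ρ x) = 1 - hsInner Q ρ := by
          simp only [hsInner_sub_left, Finset.sum_sub_distrib, hsInner_one_left, hb.2,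
            hsInner_eq_sum_block hρ]
        have h2 : ∑ f : X → Fin n, N⁻¹ * ∑ x, ∑ y ∈ Finset.univ.erase x,
            (if f y = f x then 1 else 0) * hsInner (block Q y) (block ρ x) =
            (∑ x, ∑ y ∈ Finset.univ.erase x, hsInner (block Q y) (block ρ x)) * (n : ℝ)⁻¹ := by
          rw [← Finset.mul_sum, Finset.sum_comm, Finset.mul_sum, Finset.sum_mul]
          refine Finset.sum_congr rfl fun x _ => ?_
          rw [Finset.sum_comm, Finset.mul_sum, Finset.sum_mul]
          refine Finset.sum_congr rfl fun y hy => ?_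
          rw [← hcoll x y hy, ← Finset.sum_mul]
          ring
        have h3 : ∀ v : ℝ, ∑ _f : X → Fin n, N⁻¹ * v = v := by
          intro v
          rw [Finset.sum_const, Finset.card_univ, nsmul_eq_mul, ← hN, ← mul_assoc,
            mul_inv_cancel₀ hN0.ne', one_mul]
        have h4 : ∀ f : X → Fin n, N⁻¹ * ∑ x, ((1 + c) * hsInner (1 - block Q x) (block ρ x) +
            (2 + c + c⁻¹) * (∑ y ∈ Finset.univ.erase x, (if f y = f x then 1 else 0) *
              hsInner (block Q y) (block ρ x) + δ * (block ρ x).trace.re)) =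
            N⁻¹ * ((1 + c) * (1 - hsInner Q ρ)) + (2 + c + c⁻¹) * (N⁻¹ * ∑ x,
              ∑ y ∈ Finset.univ.erase x, (if f y = f x then 1 else 0) *
                hsInner (block Q y) (block ρ x)) + N⁻¹ * ((2 + c + c⁻¹) * δ) := by
          intro f
          rw [Finset.sum_add_distrib, ← Finset.mul_sum, ← Finset.mul_sum, Finset.sum_add_distrib,
            ← Finset.mul_sum, h1, hb.2]
          ring
        rw [Finset.sum_congr rfl fun f _ => h4 f, Finset.sum_add_distrib,
          Finset.sum_add_distrib, h3, h3, ← Finset.mul_sum, h2]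
        ring
    _ ≤ _ := by
        rw [div_eq_mul_inv]
        gcongr

lemma IsTest.compressible {ρ : Matrix (X × B) (X × B) ℂ} (hρ : IsCQState ρ) {ε η : ℝ}
    (hη : 0 < η) (hηε : η ≤ ε) {Q : Matrix (X × B) (X × B) ℂ} (hQ : IsTest (ε - η) ρ Q) {m : ℕ}
    (hm : hsInner Q ((1 : Matrix X X ℂ) ⊗ₖ traceLeft ρ) < 2 ^ m * (η ^ 2 / (4 * ε))) :
    Compressible ε ρ m := by
  have hε : 0 < ε := hη.trans_le hηε
  have hd : 0 < 2 * ε - η := by linarith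
  have hn : (0 : ℝ) < ((2 ^ m : ℕ) : ℝ) := by positivity
  set t := hsInner Q ((1 : Matrix X X ℂ) ⊗ₖ traceLeft ρ) with ht
  have hδ : 0 < η ^ 2 / (4 * ε) - t / ((2 ^ m : ℕ) : ℝ) := by
    rw [sub_pos, div_lt_iff₀ hn, mul_comm]
    exact_mod_cast hm
  -- For c = η/(2ε - η), 1 + c = 2ε/(2ε - η) and 2 + c + 1/c = 4ε²/(η(2ε - η)). As δ fills the slack
  -- up to η²/(4ε), the bound (1 + c)(ε - η) + (2 + c + 1/c)η²/(4ε) is exactly ε.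
  obtain ⟨k, P, hP⟩ := exists_protocol hρ hQ.1 hQ.2.1 (n := 2 ^ m) (by positivity)
    (div_pos hη hd) hδ
  refine ⟨k, 2 ^ m, P, ?_, hP.trans ?_⟩
  · rw [Nat.cast_pow, Nat.cast_ofNat, Real.logb_pow, Real.logb_self_eq_one one_lt_two, mul_one]
  · rw [← ht, add_sub_cancel]
    have h1 : 1 - hsInner Q ρ ≤ ε - η := by linarith [hQ.2.2]
    have hc : 0 ≤ 1 + η / (2 * ε - η) := by positivity
    refine (add_le_add_left (mul_le_mul_of_nonneg_left h1 hc) _).trans_eq ?_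
    field_simp
    ring

lemma elog2_le_natCast {t : ℝ} {m : ℕ} (h : t ≤ 2 ^ m) : elog2 t ≤ ((m : ℝ) : EReal) := by
  rw [elog2]
  split_ifs with ht
  · exact bot_le
  · rw [EReal.coe_le_coe_iff, Real.logb_le_iff_le_rpow one_lt_two (not_le.mp ht)]
    exact_mod_cast h

theorem condEntropyH_le_minCompressionLength {ρ : Matrix (X × B) (X × B) ℂ} (hρ : IsCQState ρ)
    (ε : ℝ) : condEntropyH ε ρ ≤ minCompressionLength ε ρ := by
  refine iSup₂_le fun σ hσ => le_iInf₂ fun m hm => ?_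
  rw [condEntropyHRel, relEntropyH, neg_neg]
  refine elog2_le_natCast ?_
  obtain ⟨Q, hQ, hle⟩ := hm.exists_test hρ hσ
  refine le_trans (csInf_le ⟨0, ?_⟩ ⟨Q, hQ, rfl⟩) hle
  rintro _ ⟨K, hK, rfl⟩
  exact hsInner_nonneg hK.1 (Matrix.PosSemidef.one.kronecker hσ.1)

theorem minCompressionLength_le {ρ : Matrix (X × B) (X × B) ℂ} (hρ : IsCQState ρ) {ε η : ℝ}
    (hη : 0 < η) (hηε : η ≤ ε) (hε : ε < 1) :
    minCompressionLength ε ρ ≤ condEntropyHRel (ε - η) ρ (traceLeft ρ) +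
      ((Real.logb 2 (ε / η ^ 2) + 3 : ℝ) : EReal) := by
  have hb := hρ.exists_block
  rw [condEntropyHRel, relEntropyH, neg_neg]
  set T : Set ℝ := {t : ℝ | ∃ Q : Matrix (X × B) (X × B) ℂ, IsTest (ε - η) ρ Q ∧
    t = hsInner Q ((1 : Matrix X X ℂ) ⊗ₖ traceLeft ρ)}
  have hne : T.Nonempty := by
    refine ⟨_, 1, ⟨Matrix.PosSemidef.one, ?_, ?_⟩, rfl⟩
    · rw [sub_self]
      exact Matrix.PosSemidef.zero
    · have h1 : ∀ x : X, block (1 : Matrix (X × B) (X × B) ℂ) x = 1 := fun x => by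
        ext b c
        simp [block, Matrix.one_apply]
      simp only [hsInner_eq_sum_block hρ, h1, hsInner_one_left, hb.2]
      linarith
  -- For a classical-quantum state ρ ≤ 1 ⊗ ρ_B, so every admissible test has value at least its
  -- acceptance probability.
  have hlow : 1 - (ε - η) ≤ sInf T := by
    refine le_csInf hne ?_
    rintro _ ⟨Q, hQ, rfl⟩
    refine hQ.2.2.trans ?_
    rw [hsInner_one_kronecker, hsInner_eq_sum_block hρ, traceLeft_eq_sum_block]
    simp only [hsInner_sum_right]
    exact Finset.sum_le_sum fun x _ => Finset.single_le_sum
      (f := fun y => hsInner (block Q x) (block ρ y))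
      (fun y _ => hsInner_nonneg (block_posSemidef hQ.1 x) (hb.1 y)) (Finset.mem_univ x)
  have hε0 : 0 < ε := hη.trans_le hηε
  have hpos : 0 < sInf T := lt_of_lt_of_le (by linarith) hlow
  rw [elog2, if_neg hpos.not_ge, ← EReal.coe_add]
  set y : ℝ := Real.logb 2 (4 * ε * sInf T / η ^ 2) with hy
  have hyeq : Real.logb 2 (sInf T) + (Real.logb 2 (ε / η ^ 2) + 3) = y + 1 := by
    have h4 : Real.logb 2 4 = 2 := by
      rw [show (4 : ℝ) = 2 ^ 2 by norm_num, Real.logb_pow, Real.logb_self_eq_one one_lt_two]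
      norm_num
    rw [hy, show 4 * ε * sInf T / η ^ 2 = 4 * (sInf T * (ε / η ^ 2)) by ring,
      Real.logb_mul (by norm_num) (by positivity), Real.logb_mul hpos.ne' (by positivity), h4]
    ring
  -- Needed because the natural-number floor exceeds a negative y.
  have hy0 : 0 ≤ y := by
    refine Real.logb_nonneg one_lt_two ?_
    rw [le_div_iff₀ (by positivity)]
    have h1 : ε * (1 - (ε - η)) ≤ ε * sInf T := mul_le_mul_of_nonneg_left hlow hε0.le
    nlinarith [mul_nonneg (sub_nonneg.mpr hηε) (sub_nonneg.mpr hε.le)]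
  rw [hyeq]
  -- The length ⌊y⌋ + 1 makes the inequality strict, so a test near the infimum suffices and
  -- attainment is not needed. The rounding costs one bit and the factor 4 costs two: together the
  -- constant 3.
  have hlt : 4 * ε * sInf T / η ^ 2 < 2 ^ (⌊y⌋₊ + 1) := by
    have := Nat.lt_floor_add_one y
    rw [hy, Real.logb_lt_iff_lt_rpow one_lt_two (by positivity)] at this
    exact_mod_cast this
  obtain ⟨_, ⟨Q, hQ, rfl⟩, hQlt⟩ := exists_lt_of_csInf_lt hne
    (b := 2 ^ (⌊y⌋₊ + 1) * (η ^ 2 / (4 * ε))) (by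
      rw [div_lt_iff₀ (by positivity)] at hlt
      rw [← mul_div_assoc, lt_div_iff₀ (by positivity)]
      linarith)
  refine (iInf₂_le (⌊y⌋₊ + 1) (hQ.compressible hρ hη hηε hQlt)).trans ?_
  rw [EReal.coe_le_coe_iff, Nat.cast_add_one]
  exact add_le_add_left (Nat.floor_le hy0) 1

end BlockDiag

end SourceCompression

end

theorem mainTheorem2 {X B : Type*} [Fintype X] [DecidableEq X] [Fintype B] [DecidableEq B]
    (ρ : Matrix (X × B) (X × B) ℂ) (hρ : SourceCompression.IsCQState ρ)
    (ε η : ℝ) (hη : 0 < η) (hηε : η ≤ ε) (hε : ε < 1) :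
    SourceCompression.condEntropyH ε ρ ≤ SourceCompression.minCompressionLength ε ρ ∧
    SourceCompression.minCompressionLength ε ρ ≤
      SourceCompression.condEntropyHRel (ε - η) ρ (SourceCompression.traceLeft ρ) +
        ((Real.logb 2 (ε / η ^ 2) + 3 : ℝ) : EReal) := by
  exact ⟨SourceCompression.condEntropyH_le_minCompressionLength hρ ε,
    SourceCompression.minCompressionLength_le hρ hη hηε hε⟩
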